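/- \textbf{Model.} Let $A$ be a Normal linear sociability network with $n$ nodes, $K_*$ communities and constant error variance $\sigma^2\ge 0$: $A$ is a random symmetric $n\times n$ matrix with zero diagonal and, for $u\ne v$ in communities $i$ and $j$, $$A_{uv}=\gamma_{ij}+\alpha_{ij}Z_u^{(j)}+\beta_{ij}Z_v^{(i)}+\sigma\,\epsilon_{uv},\qquad \gamma_{ij}=\gamma_{ji},\quad \beta_{ij}=\alpha_{ji},\quad \epsilon_{uv}=\epsilon_{vu}.$$ Here $\gamma_{ij},\alpha_{ij}\in\mathbb R$; the sociabilities $Z_u^{(j)}$ are $\mathcal N(0,1)$ and independent across nodes $u$ (for one node they may depend on each other, e.g. $Z_u^{(j)}=Z_u$ for all $j$); and the $\epsilon_{uv}$, $u<v$, are i.i.d. $\mathcal N(0,1)$, independent of the sociabilities. Let $P_*$ be the same network with $\sigma$ replaced by $0$. \textbf{Estimator.} For constants $C_1,C_2,C_3>0$ put $$\mathrm{Pen}(n,K)=4\big(C_1nK+C_2K^2\log n+C_3(\log n+n\log K)\big),$$ and call $K$ admissible if $$C_1nK+C_2K^2\log n+C_3(\log n+n\log K)\le \frac{n(n-1)}4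 .$$ A clustering of the nodes into $\hat K$ non-empty communities induces the estimate $\hat P$ that minimizes $\|A-P\|_F$ over all matrices $P$ of the above form with $\sigma=0$ and these communities (arbitrary real $\gamma,\alpha,Z$). Let $\hat P$ be the estimate induced by a clustering which, among all clusterings with an admissible number $\hat K$ of communities, minimizes $$\|A-\hat P\|_F^2+\hat\sigma^2\,\mathrm{Pen}(n,\hat K),\qquad \hat\sigma^2=\frac{\|A-\hat P\|_F^2}{n(n-1)} .$$ \textbf{Theorem.} There are constants $C_1,C_2>0$ and, for every $0<c<1$, constants $C_3,C>0$ depending only on $c$, such that for every network as above whose number of communities $K_*$ is admissible, and for all $t>0$ and $\epsilon\in[0,1/2)$, $$\mathbb P\Big(\|P_*-\hat P\|_F^2\le \frac{\sigma^2}{1-c}\big(Ct+(1+\epsilon)\,\mathrm{Pen}(n,K_*)\big)\Big)\ \ge\ 1-3e^{-t}-e^{-\frac3{32}\epsilon^2n(n-1)} .$$ -/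

import Mathlib

/-- The adjacency matrix of a linear sociability network on the nodes `Fin n`.

* `z u` is the community of node `u`;
* `γ s(i, j)` is the intercept of the subnetwork joining the communities `i` and `j`;
* `α i j` is the slope, in that subnetwork, of the sociability of the endpoint lying in `i`.
  The network is undirected, so the slope of the endpoint lying in `j` (usually written `β i j`)
  is `α j i`; inside a community both slopes are `α i i`;
* `Z u j` is the sociability of node `u` for its edges towards community `j` (a single global
  sociability is the case where `Z u j` does not depend on `j`);
* `σ` is the noise level and `ξ s(u, v)` the error on the edge between `u` and `v`.

There are no self-loops, so the diagonal vanishes. -/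
def lsmNetwork {n K : ℕ} (z : Fin n → Fin K) (γ : Sym2 (Fin K) → ℝ) (α : Fin K → Fin K → ℝ)
    (Z : Fin n → Fin K → ℝ) (σ : ℝ) (ξ : Sym2 (Fin n) → ℝ) : Matrix (Fin n) (Fin n) ℝ :=
  Matrix.of fun u v =>
    if u = v then 0
    else γ s(z u, z v) + α (z u) (z v) * Z u (z v) + α (z v) (z u) * Z v (z u) + σ * ξ s(u, v)

/-- The random inputs of the Normal linear sociability model on a probability space `(Ω, μ)`:
standard normal sociabilities, independent from one node to the other, and i.i.d. standard normal
errors on the edges (unordered pairs of distinct nodes), independent of the sociabilities.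
The sociabilities `Z u j`, `j : Fin K`, of one and the same node may depend on each other in any
way; in particular they may all be equal. -/
structure IsNormalLSMInput {Ω : Type*} [MeasurableSpace Ω] (μ : MeasureTheory.Measure Ω) {n K : ℕ}
    (Z : Fin n → Fin K → Ω → ℝ) (ξ : Sym2 (Fin n) → Ω → ℝ) : Prop where
  sociability_law : ∀ u j, ProbabilityTheory.HasLaw (Z u j) (ProbabilityTheory.gaussianReal 0 1) μ
  sociability_indep :
    ProbabilityTheory.iIndepFun (fun (u : Fin n) (ω : Ω) (j : Fin K) => Z u j ω) μ
  error_law : ∀ e : Sym2 (Fin n), ¬ e.IsDiag →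
    ProbabilityTheory.HasLaw (ξ e) (ProbabilityTheory.gaussianReal 0 1) μ
  error_indep :
    ProbabilityTheory.iIndepFun (fun e : {e : Sym2 (Fin n) // ¬ e.IsDiag} => ξ e.1) μ
  sociability_error_indep :
    ProbabilityTheory.IndepFun (fun (ω : Ω) (u : Fin n) (j : Fin K) => Z u j ω)
      (fun (ω : Ω) (e : {e : Sym2 (Fin n) // ¬ e.IsDiag}) => ξ e.1 ω) μ

/-- The squared Frobenius norm. -/
def frobSq {n : ℕ} (M : Matrix (Fin n) (Fin n) ℝ) : ℝ := ∑ u, ∑ v, M u v ^ 2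

section
attribute [local instance] Matrix.frobeniusNormedAddCommGroup

theorem frobSq_eq_norm_sq {n : ℕ} (M : Matrix (Fin n) (Fin n) ℝ) : frobSq M = ‖M‖ ^ 2 := by
  have h : (0 : ℝ) ≤ ∑ u, ∑ v, M u v ^ 2 := by positivity
  rw [Matrix.frobenius_norm_def, ← Real.sqrt_eq_rpow]
  simp only [Real.rpow_ofNat, Real.norm_eq_abs, sq_abs]
  rw [Real.sq_sqrt h, frobSq]

end

/-- The complexity `C₁ n K + C₂ K² log n + C₃ (log n + n log K)` of clusterings of `n` nodes into
`K` communities. -/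
noncomputable def complexity (C₁ C₂ C₃ : ℝ) (n K : ℕ) : ℝ :=
  C₁ * n * K + C₂ * (K : ℝ) ^ 2 * Real.log n + C₃ * (Real.log n + n * Real.log K)

/-- The penalty `Pen(n, K)`. -/
noncomputable def penalty (C₁ C₂ C₃ : ℝ) (n K : ℕ) : ℝ := 4 * complexity C₁ C₂ C₃ n K

/-- The restriction on the number `K` of communities of a network with `n` nodes. -/
def IsAdmissible (C₁ C₂ C₃ : ℝ) (n K : ℕ) : Prop :=
  complexity C₁ C₂ C₃ n K ≤ (n : ℝ) * ((n : ℝ) - 1) / 4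

/-- The estimate of the noise variance attached to the fit `P` of the network `A`. -/
noncomputable def sigmaHatSq {n : ℕ} (A P : Matrix (Fin n) (Fin n) ℝ) : ℝ :=
  frobSq (A - P) / ((n : ℝ) * ((n : ℝ) - 1))

/-- The criterion `‖A - P‖_F² + σ̂² Pen(n, K)`. -/
noncomputable def criterion (C₁ C₂ C₃ : ℝ) {n : ℕ} (A P : Matrix (Fin n) (Fin n) ℝ) (K : ℕ) : ℝ :=
  frobSq (A - P) + sigmaHatSq A P * penalty C₁ C₂ C₃ n K

/-- The noise-free linear sociability networks with community assignment `z`. -/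
def noiselessNetworks {n K : ℕ} (z : Fin n → Fin K) : Set (Matrix (Fin n) (Fin n) ℝ) :=
  {P | ∃ (γ : Sym2 (Fin K) → ℝ) (α : Fin K → Fin K → ℝ) (Z : Fin n → Fin K → ℝ),
    P = lsmNetwork z γ α Z 0 0}

/-- `P` is the estimate of the network `A` induced by the clustering `z`: the noise-free linear
sociability network with communities `z` which is closest to `A` in Frobenius norm. -/
def IsInducedEstimate {n K : ℕ} (A : Matrix (Fin n) (Fin n) ℝ) (z : Fin n → Fin K)
    (P : Matrix (Fin n) (Fin n) ℝ) : Prop :=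
  P ∈ noiselessNetworks z ∧ ∀ Q ∈ noiselessNetworks z, frobSq (A - P) ≤ frobSq (A - Q)

/-- `P` is induced by a clustering of the nodes which minimizes the penalized criterion among all
clusterings into an admissible number of (non-empty) communities. -/
def IsPenalizedEstimate (C₁ C₂ C₃ : ℝ) {n : ℕ} (A P : Matrix (Fin n) (Fin n) ℝ) : Prop :=
  ∃ (Khat : ℕ) (zhat : Fin n → Fin Khat), Function.Surjective zhat ∧
    IsAdmissible C₁ C₂ C₃ n Khat ∧ IsInducedEstimate A zhat P ∧
    ∀ (K : ℕ) (z : Fin n → Fin K) (Q : Matrix (Fin n) (Fin n) ℝ), Function.Surjective z →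
      IsAdmissible C₁ C₂ C₃ n K → IsInducedEstimate A z Q →
      criterion C₁ C₂ C₃ A P Khat ≤ criterion C₁ C₂ C₃ A Q K

/-! In terms of edge weights, the noiseless networks with given communities form a linear space,
of dimension at most `n K`, so induced estimates are orthogonal projections `S y` of
`y = p + σ x`, where `p` is the signal and `x` is a standard Gaussian vector. The loss
`‖p - S y‖²` and the residual `‖y - S y‖²` share the bias `‖p - S p‖²`; otherwise they differ by
`χ²` terms and the cross term `2 σ ⟪p - S p, x⟫`. Conditionally on the signal, which is
independent of `x`, the cross term is a Gaussian of variance `4 σ² ‖p - S p‖²`, so by AM-GM it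
costs at most a fraction `c` of the bias and a multiple of `σ² s`. Taking
`s = t + log n + n log K` makes this uniform over clusterings, because the weights
`exp (-(log n + n log K))` of all clusterings sum to one.

The criterion multiplies residuals by `1 + Pen / (n (n - 1))`. Since `‖x‖²` is, up to `2 t`, at
least half the number `n (n - 1) / 2` of edges, the penalty of the selected clustering pays for
all these fluctuations; since `‖x‖²` is at most `1 + ε` times the number of edges, the penalty
of the true clustering costs at most `(1 + ε) Pen` in Frobenius norm. -/

open MeasureTheory ProbabilityTheory WithLp
open scoped RealInnerProductSpace

section Log

-- The right-hand side is the Padé approximant of order `[2/1]` of `log (1 + x)` at `0`.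
theorem log_one_add_le_padeTwoOne {x : ℝ} (hx : 0 ≤ x) :
    Real.log (1 + x) ≤ x * (6 + x) / (6 + 4 * x) := by
  let gap : ℝ → ℝ := fun y => y * (6 + y) / (6 + 4 * y) - Real.log (1 + y)
  have hderiv : ∀ y, 0 ≤ y →
      HasDerivAt gap (4 * y ^ 3 / ((6 + 4 * y) ^ 2 * (1 + y))) y := fun y hy => by
    have hden : 6 + 4 * y ≠ 0 := by positivity
    have harg : 1 + y ≠ 0 := by positivity
    have hid := hasDerivAt_id y
    refine (((hid.mul (hid.const_add 6)).div ((hid.const_mul 4).const_add 6) hden).sub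
      ((hid.const_add 1).log harg)).congr_deriv ?_
    simp only [id, Pi.mul_apply]
    field_simp
    ring
  have hmono : MonotoneOn gap (Set.Ici 0) := by
    refine monotoneOn_of_deriv_nonneg (convex_Ici 0)
      (fun y hy => (hderiv y hy).continuousAt.continuousWithinAt)
      (fun y hy => (hderiv y (interior_subset hy)).differentiableAt.differentiableWithinAt)
      fun y hy => ?_
    have hy₀ : 0 ≤ y := interior_subset hy
    rw [(hderiv y hy₀).deriv]
    positivity
  simpa [gap] using hmono Set.self_mem_Ici hx hx

theorem log_one_add_le_sub_sq {x : ℝ} (hx₀ : 0 ≤ x) (hx₁ : x ≤ 1 / 2) :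
    Real.log (1 + x) ≤ x - 3 / 8 * x ^ 2 := by
  refine (log_one_add_le_padeTwoOne hx₀).trans ?_
  rw [div_le_iff₀ (by positivity)]
  nlinarith [mul_nonneg (sq_nonneg x) (sub_nonneg.2 hx₁)]

end Log

section GaussianReal

theorem gaussianPDFReal_mul_exp_mul_sq (s x : ℝ) :
    gaussianPDFReal 0 1 x * Real.exp (s * x ^ 2) =
      (√(2 * Real.pi))⁻¹ * Real.exp (-(1 / 2 - s) * x ^ 2) := by
  simp only [gaussianPDFReal, NNReal.coe_one, mul_one, sub_zero]
  rw [mul_assoc, ← Real.exp_add]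
  ring_nf

variable {s : ℝ}

theorem integrable_exp_mul_sq_gaussianReal (hs : s < 1 / 2) :
    Integrable (fun x => Real.exp (s * x ^ 2)) (gaussianReal 0 1) := by
  rw [gaussianReal_of_var_ne_zero 0 one_ne_zero, integrable_withDensity_iff
    (measurable_gaussianPDF 0 1) (ae_of_all _ fun _ => gaussianPDF_lt_top)]
  simp_rw [toReal_gaussianPDF, mul_comm (Real.exp _), gaussianPDFReal_mul_exp_mul_sq]
  exact (integrable_exp_neg_mul_sq (sub_pos.2 hs)).const_mul _

theorem mgf_sq_gaussianReal (hs : s < 1 / 2) :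
    mgf (fun x => x ^ 2) (gaussianReal 0 1) s = (√(1 - 2 * s))⁻¹ := by
  rw [mgf, integral_gaussianReal_eq_integral_smul one_ne_zero]
  simp_rw [smul_eq_mul, gaussianPDFReal_mul_exp_mul_sq]
  rw [integral_const_mul, integral_gaussian, ← Real.sqrt_inv, ← Real.sqrt_inv,
    ← Real.sqrt_mul (by positivity)]
  have : 1 - 2 * s ≠ 0 := by linarith
  have : 1 / 2 - s ≠ 0 := by linarith
  congr 1
  field_simp

end GaussianReal

section StdGaussian

variable {E : Type*} [NormedAddCommGroup E] [InnerProductSpace ℝ E]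

theorem exp_mul_norm_sq_sum_orthonormalBasis {ι : Type*} [Fintype ι] (b : OrthonormalBasis ι ℝ E)
    (s : ℝ) (x : ι → ℝ) :
    Real.exp (s * ‖∑ i, x i • b i‖ ^ 2) = ∏ i, Real.exp (s * x i ^ 2) := by
  simp only [← Real.exp_sum, ← Finset.mul_sum, ← b.sum_sq_norm_inner_right,
    b.orthonormal.inner_right_fintype, Real.norm_eq_abs, sq_abs]

variable [FiniteDimensional ℝ E] [MeasurableSpace E] [BorelSpace E]

theorem integrable_exp_mul_norm_sq_stdGaussian {s : ℝ} (hs : s < 1 / 2) :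
    Integrable (fun x => Real.exp (s * ‖x‖ ^ 2)) (stdGaussian E) := by
  rw [stdGaussian_eq_map_pi_orthonormalBasis (stdOrthonormalBasis ℝ E),
    integrable_map_measure (by fun_prop) (Measurable.aemeasurable (by fun_prop))]
  simp only [Function.comp_def, exp_mul_norm_sq_sum_orthonormalBasis]
  exact Integrable.fintype_prod fun _ => integrable_exp_mul_sq_gaussianReal hs

theorem mgf_norm_sq_stdGaussian {s : ℝ} (hs : s < 1 / 2) :
    mgf (fun x => ‖x‖ ^ 2) (stdGaussian E) s =
      (1 - 2 * s) ^ (-(Module.finrank ℝ E / 2) : ℝ) := by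
  have hpos : 0 ≤ 1 - 2 * s := by linarith
  have hcoord : ∫ x, Real.exp (s * x ^ 2) ∂gaussianReal 0 1 = (√(1 - 2 * s))⁻¹ :=
    mgf_sq_gaussianReal hs
  rw [mgf, stdGaussian_eq_map_pi_orthonormalBasis (stdOrthonormalBasis ℝ E),
    integral_map (Measurable.aemeasurable (by fun_prop)) (by fun_prop)]
  simp only [exp_mul_norm_sq_sum_orthonormalBasis]
  rw [integral_fintype_prod_eq_prod (𝕜 := ℝ) (fun _ x => Real.exp (s * x ^ 2)), hcoord,
    Finset.prod_const, Finset.card_univ, Fintype.card_fin, Real.sqrt_eq_rpow,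
    ← Real.rpow_neg hpos, ← Real.rpow_natCast, ← Real.rpow_mul hpos]
  ring_nf

-- Chernoff's bound at its optimal parameter `ε / (2 (1 + ε))`.
theorem stdGaussian_real_norm_sq_ge_le {ε : ℝ} (hε₀ : 0 ≤ ε) (hε₁ : ε ≤ 1 / 2) :
    (stdGaussian E).real {x | Module.finrank ℝ E * (1 + ε) ≤ ‖x‖ ^ 2} ≤
      Real.exp (-(3 / 16 * ε ^ 2 * Module.finrank ℝ E)) := by
  have hs : ε / (2 * (1 + ε)) < 1 / 2 := by
    rw [div_lt_div_iff₀ (by positivity) two_pos]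
    linarith
  have hbase : 1 - 2 * (ε / (2 * (1 + ε))) = (1 + ε)⁻¹ := by
    field_simp
    ring
  have hlevel : -(ε / (2 * (1 + ε))) * (Module.finrank ℝ E * (1 + ε)) =
      -(Module.finrank ℝ E / 2 * ε) := by
    field_simp
  have hlog := mul_le_mul_of_nonneg_left (log_one_add_le_sub_sq hε₀ hε₁)
    (by positivity : (0 : ℝ) ≤ Module.finrank ℝ E / 2)
  refine (measure_ge_le_exp_mul_mgf _ (by positivity)
    (integrable_exp_mul_norm_sq_stdGaussian hs)).trans ?_
  rw [mgf_norm_sq_stdGaussian hs, hbase, hlevel, Real.rpow_def_of_pos (by positivity),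
    ← Real.exp_add, Real.log_inv, Real.exp_le_exp]
  linarith

theorem stdGaussian_real_norm_sq_le_le (t : ℝ) :
    (stdGaussian E).real {x | ‖x‖ ^ 2 ≤ Module.finrank ℝ E / 2 - 2 * t} ≤ Real.exp (-t) := by
  have hlog : 1 / 2 ≤ Real.log 2 := by linarith [Real.log_two_gt_d9]
  refine (measure_le_le_exp_mul_mgf _ (by norm_num : (-1 / 2 : ℝ) ≤ 0)
    (integrable_exp_mul_norm_sq_stdGaussian (by norm_num))).trans ?_
  rw [mgf_norm_sq_stdGaussian (by norm_num), show (1 : ℝ) - 2 * (-1 / 2) = 2 by norm_num,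
    Real.rpow_def_of_pos two_pos, ← Real.exp_add, Real.exp_le_exp]
  linarith [mul_le_mul_of_nonneg_left hlog (by positivity : (0 : ℝ) ≤ Module.finrank ℝ E / 2)]

theorem stdGaussian_real_norm_sq_ge_le_exp_neg (t : ℝ) :
    (stdGaussian E).real {x | 2 * Module.finrank ℝ E + 4 * t ≤ ‖x‖ ^ 2} ≤ Real.exp (-t) := by
  have hlog : Real.log 2 ≤ 1 := by linarith [Real.log_two_lt_d9]
  refine (measure_ge_le_exp_mul_mgf _ (by norm_num : (0 : ℝ) ≤ 1 / 4)
    (integrable_exp_mul_norm_sq_stdGaussian (by norm_num))).trans ?_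
  rw [mgf_norm_sq_stdGaussian (by norm_num), show (1 : ℝ) - 2 * (1 / 4) = 2⁻¹ by norm_num,
    Real.rpow_def_of_pos (by positivity), ← Real.exp_add, Real.log_inv, Real.exp_le_exp]
  linarith [mul_le_mul_of_nonneg_left hlog (by positivity : (0 : ℝ) ≤ Module.finrank ℝ E / 2)]

theorem stdGaussian_map_orthogonalProjectionOnto (S : Submodule ℝ E) :
    (stdGaussian E).map S.orthogonalProjectionOnto = stdGaussian S := by
  have : IsProbabilityMeasure ((stdGaussian E).map S.orthogonalProjectionOnto) :=
    Measure.isProbabilityMeasure_map (by fun_prop)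
  refine Measure.ext_of_charFun ?_
  ext v
  have hinner : ∀ x : E, ⟪S.orthogonalProjectionOnto x, v⟫ = ⟪x, (v : E)⟫ := fun x => by
    rw [← Submodule.inner_orthogonalProjectionOnto_eq_of_mem_right]
  rw [charFun_apply, integral_map (by fun_prop) (by fun_prop)]
  simp_rw [hinner]
  rw [← charFun_apply, charFun_stdGaussian, charFun_stdGaussian, Submodule.coe_norm]

theorem stdGaussian_real_norm_sq_starProjection_ge_le (S : Submodule ℝ E) (t : ℝ) :
    (stdGaussian E).real {x | 2 * Module.finrank ℝ S + 4 * t ≤ ‖S.starProjection x‖ ^ 2} ≤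
      Real.exp (-t) := by
  have h := stdGaussian_real_norm_sq_ge_le_exp_neg (E := S) t
  rwa [← stdGaussian_map_orthogonalProjectionOnto, map_measureReal_apply (by fun_prop)
    (measurableSet_le (by fun_prop) (by fun_prop))] at h

theorem stdGaussian_map_inner (a : E) :
    (stdGaussian E).map (fun x => ⟪a, x⟫) = gaussianReal 0 (‖a‖₊ ^ 2) := by
  have h := IsGaussian.map_eq_gaussianReal (μ := stdGaussian E) (innerSL ℝ a)
  rw [integral_strongDual_stdGaussian, variance_dual_stdGaussian, innerSL_apply_norm] at h
  rwa [Real.toNNReal_pow (norm_nonneg a), norm_toNNReal] at h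

theorem hasSubgaussianMGF_inner_stdGaussian (a : E) :
    HasSubgaussianMGF (fun x => ⟪a, x⟫) (‖a‖₊ ^ 2) (stdGaussian E) where
  integrable_exp_mul t := by
    have h := integrable_exp_mul_gaussianReal (μ := 0) (v := ‖a‖₊ ^ 2) t
    rwa [← stdGaussian_map_inner a, integrable_map_measure (by fun_prop) (by fun_prop)] at h
  mgf_le t := by rw [mgf_gaussianReal (stdGaussian_map_inner a), zero_mul, zero_add]

theorem stdGaussian_real_inner_lt_le (a : E) (t : ℝ) :
    (stdGaussian E).real {x | ⟪a, x⟫ < -(√(2 * t) * ‖a‖)} ≤ Real.exp (-t) := by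
  rcases eq_or_ne a 0 with rfl | ha
  · simp [Real.exp_nonneg]
  have hsub := (hasSubgaussianMGF_inner_stdGaussian a).neg
  have hc : 0 < ‖a‖ ^ 2 := by positivity
  have hsq : 2 * t ≤ √(2 * t) ^ 2 := (le_max_left _ _).trans_eq Real.sq_sqrt'.symm
  refine (measureReal_mono fun x (hx : ⟪a, x⟫ < _) => ?_).trans
    ((hsub.measure_ge_le (ε := √(2 * t) * ‖a‖) (by positivity)).trans ?_)
  · exact le_neg_of_le_neg hx.le
  · rw [Real.exp_le_exp, NNReal.coe_pow, coe_nnnorm, mul_pow, neg_div, neg_le_neg_iff,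
      mul_div_mul_right _ _ hc.ne']
    linarith

end StdGaussian

section Probability

variable {Ω : Type*} [MeasurableSpace Ω] {μ : Measure Ω}

theorem measureReal_le_of_indepFun {α β : Type*} [MeasurableSpace α] [MeasurableSpace β]
    {ν : Measure β} [IsProbabilityMeasure ν] {X : Ω → α} {Y : Ω → β} (hX : AEMeasurable X μ)
    (hY : HasLaw Y ν μ) (hXY : X ⟂ᵢ[μ] Y) {s : Set (α × β)} (hs : MeasurableSet s) {r : ℝ}
    (h : ∀ a, ν.real (Prod.mk a ⁻¹' s) ≤ r) : μ.real ((fun ω => (X ω, Y ω)) ⁻¹' s) ≤ r := by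
  have := hY.isProbabilityMeasure
  have := Measure.isProbabilityMeasure_map hX
  obtain ⟨ω⟩ := nonempty_of_isProbabilityMeasure μ
  have hr : 0 ≤ r := measureReal_nonneg.trans (h (X ω))
  have hlaw := IndepFun.hasLaw_prod ⟨hX, rfl⟩ hY hXY
  rw [← map_measureReal_apply_of_aemeasurable hlaw.aemeasurable hs, hlaw.map_eq]
  refine ENNReal.toReal_le_of_le_ofReal hr ?_
  rw [Measure.prod_apply hs]
  refine (lintegral_mono (g := fun _ => ENNReal.ofReal r) fun a => ?_).trans (by simp)
  exact (ENNReal.le_ofReal_iff_toReal_le (measure_ne_top _ _) hr).2 (h a)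

theorem measureReal_iUnion_le_exp_neg {ι : Type*} [Fintype ι] {L : ι → ℝ}
    (hL : ∑ i, Real.exp (-L i) ≤ 1) {B : ι → Set Ω} {t : ℝ}
    (hB : ∀ i, μ.real (B i) ≤ Real.exp (-(t + L i))) : μ.real (⋃ i, B i) ≤ Real.exp (-t) :=
  calc
    μ.real (⋃ i, B i) ≤ ∑ i, Real.exp (-(t + L i)) :=
      (measureReal_iUnion_fintype_le _).trans (Finset.sum_le_sum fun i _ => hB i)
    _ = Real.exp (-t) * ∑ i, Real.exp (-L i) := by
      simp only [neg_add, Real.exp_add, Finset.mul_sum]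
    _ ≤ Real.exp (-t) := mul_le_of_le_one_right (Real.exp_nonneg _) hL

theorem exists_measurableSet_of_measureReal_not_le [IsProbabilityMeasure μ] {P : Ω → Prop} {r : ℝ}
    (h : μ.real {ω | ¬ P ω} ≤ r) :
    ∃ E, MeasurableSet E ∧ 1 - r ≤ μ.real E ∧ ∀ ω ∈ E, P ω := by
  obtain ⟨B, hsub, hB, hμB⟩ := exists_measurable_superset μ {ω | ¬ P ω}
  refine ⟨Bᶜ, hB.compl, ?_, fun ω hω => by_contra fun hP => hω (hsub hP)⟩
  rw [probReal_compl_eq_one_sub hB, measureReal_def, hμB, ← measureReal_def]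
  linarith

end Probability

section StarProjection

variable {E : Type*} [NormedAddCommGroup E] [InnerProductSpace ℝ E] (S : Submodule ℝ E)
  [S.HasOrthogonalProjection]

theorem inner_sub_starProjection_starProjection (x y : E) :
    ⟪x - S.starProjection x, S.starProjection y⟫ = 0 :=
  S.starProjection_inner_eq_zero x _ (S.starProjection_apply_mem y)

theorem norm_sub_sq_eq_add_of_mem (y : E) {q : E} (hq : q ∈ S) :
    ‖y - q‖ ^ 2 = ‖y - S.starProjection y‖ ^ 2 + ‖S.starProjection y - q‖ ^ 2 := by
  have horth : ⟪y - S.starProjection y, S.starProjection y - q⟫ = 0 :=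
    S.starProjection_inner_eq_zero y _ (S.sub_mem (S.starProjection_apply_mem y) hq)
  rw [← sub_add_sub_cancel y (S.starProjection y) q, norm_add_sq_real, horth]
  ring

theorem norm_sub_starProjection_add_smul_sq (p x : E) (σ : ℝ) :
    ‖p - S.starProjection (p + σ • x)‖ ^ 2 =
      ‖p - S.starProjection p‖ ^ 2 + σ ^ 2 * ‖S.starProjection x‖ ^ 2 := by
  rw [map_add, map_smul, ← sub_sub, norm_sub_sq_real, inner_smul_right,
    inner_sub_starProjection_starProjection, norm_smul, mul_pow, Real.norm_eq_abs, sq_abs]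
  ring

theorem norm_add_smul_sub_starProjection_sq (p x : E) (σ : ℝ) :
    ‖p + σ • x - S.starProjection (p + σ • x)‖ ^ 2 =
      ‖p - S.starProjection p‖ ^ 2 + 2 * σ * ⟪p - S.starProjection p, x⟫ +
        σ ^ 2 * (‖x‖ ^ 2 - ‖S.starProjection x‖ ^ 2) := by
  have hpyth := norm_sub_sq_eq_add_of_mem S x S.zero_mem
  rw [sub_zero, sub_zero] at hpyth
  rw [map_add, map_smul, add_sub_add_comm, ← smul_sub, norm_add_sq_real, inner_smul_right,
    inner_sub_right, inner_sub_starProjection_starProjection, norm_smul, mul_pow,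
    Real.norm_eq_abs, sq_abs, hpyth]
  ring

variable {S} {p x : E} {s σ : ℝ}

theorem neg_le_two_mul_mul_inner_sub_starProjection {r : ℝ} (hs : 0 ≤ s) (hσ : 0 ≤ σ) (hr : 0 < r)
    (hx : -(√(2 * s) * ‖p - S.starProjection p‖) ≤ ⟪p - S.starProjection p, x⟫) :
    -(r * ‖p - S.starProjection p‖ ^ 2 + σ ^ 2 * (2 * s / r)) ≤
      2 * σ * ⟪p - S.starProjection p, x⟫ := by
  have hyoung := two_mul_le_add_mul_sq (a := ‖p - S.starProjection p‖) (b := σ * √(2 * s)) hr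
  rw [mul_pow, Real.sq_sqrt (by positivity), inv_mul_eq_div, mul_div_assoc] at hyoung
  have hmul := mul_le_mul_of_nonneg_left hx (by positivity : 0 ≤ 2 * σ)
  linarith

theorem mul_sub_sub_le_norm_add_smul_sub_starProjection_sq (hs : 0 ≤ s) (hσ : 0 ≤ σ)
    (hx : -(√(2 * s) * ‖p - S.starProjection p‖) ≤ ⟪p - S.starProjection p, x⟫) :
    σ ^ 2 * (‖x‖ ^ 2 - ‖S.starProjection x‖ ^ 2 - 2 * s) ≤
      ‖p + σ • x - S.starProjection (p + σ • x)‖ ^ 2 := by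
  have hcross := neg_le_two_mul_mul_inner_sub_starProjection hs hσ one_pos hx
  rw [norm_add_smul_sub_starProjection_sq]
  linarith

theorem one_sub_mul_norm_sub_starProjection_add_smul_sq_le {c : ℝ} (hs : 0 ≤ s) (hσ : 0 ≤ σ)
    (hc : 0 < c)
    (hx : -(√(2 * s) * ‖p - S.starProjection p‖) ≤ ⟪p - S.starProjection p, x⟫) :
    (1 - c) * ‖p - S.starProjection (p + σ • x)‖ ^ 2 ≤
      ‖p + σ • x - S.starProjection (p + σ • x)‖ ^ 2 - σ ^ 2 * ‖x‖ ^ 2 +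
        σ ^ 2 * (2 * ‖S.starProjection x‖ ^ 2 + 2 * s / c) := by
  have hcross := neg_le_two_mul_mul_inner_sub_starProjection hs hσ hc hx
  have hnonneg : 0 ≤ c * (σ ^ 2 * ‖S.starProjection x‖ ^ 2) := by positivity
  rw [norm_sub_starProjection_add_smul_sq, norm_add_smul_sub_starProjection_sq]
  linarith

end StarProjection

section PenalizedProjection

variable {E : Type*} [NormedAddCommGroup E] [InnerProductSpace ℝ E] [FiniteDimensional ℝ E]
  {ι : Type*} {S : ι → Submodule ℝ E} {L : ι → ℝ} {t ε : ℝ}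

/-- The event on which least squares over the models `S i`, weighted by `L i`, behaves as it should
for the observation `p + σ • x`: at confidence levels set by `t` and `ε`, the noise `x` is not
unusually long or short, no model overfits it, and it does not point from `p` towards a model. -/
structure IsTypicalNoise (S : ι → Submodule ℝ E) (L : ι → ℝ) (t ε : ℝ) (p x : E) : Prop where
  norm_sq_le : ‖x‖ ^ 2 ≤ Module.finrank ℝ E * (1 + ε)
  le_norm_sq : Module.finrank ℝ E / 2 - 2 * t ≤ ‖x‖ ^ 2
  norm_sq_starProjection_le (i : ι) :
    ‖(S i).starProjection x‖ ^ 2 ≤ 2 * Module.finrank ℝ (S i) + 4 * (t + L i)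
  le_inner_sub_starProjection (i : ι) :
    -(√(2 * (t + L i)) * ‖p - (S i).starProjection p‖) ≤ ⟪p - (S i).starProjection p, x⟫

theorem IsTypicalNoise.one_sub_mul_norm_sub_starProjection_sq_le {p x : E}
    (hx : IsTypicalNoise S L t ε p x) {c σ ρ ρ' : ℝ} (hc : 0 < c) (hσ : 0 ≤ σ) (ht : 0 ≤ t)
    {i : ι} (hL : 0 ≤ L i) (hρ₀ : 0 ≤ ρ) (hρ₁ : ρ ≤ 1) (hρ' : 0 ≤ ρ')
    (hcost : 6 * Module.finrank ℝ (S i) + (14 + 2 / c) * L i ≤ Module.finrank ℝ E * ρ / 2)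
    (hcrit : ‖p + σ • x - (S i).starProjection (p + σ • x)‖ ^ 2 * (1 + ρ) ≤
      σ ^ 2 * ‖x‖ ^ 2 * (1 + ρ')) :
    (1 - c) * ‖p - (S i).starProjection (p + σ • x)‖ ^ 2 ≤
      σ ^ 2 * ((16 + 2 / c) * t + (1 + ε) * (Module.finrank ℝ E * ρ')) := by
  have hs : 0 ≤ t + L i := add_nonneg ht hL
  have hloss := one_sub_mul_norm_sub_starProjection_add_smul_sq_le hs hσ hc
    (hx.le_inner_sub_starProjection i)
  have hresid := mul_le_mul_of_nonneg_right (mul_sub_sub_le_norm_add_smul_sub_starProjection_sq hs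
    hσ (hx.le_inner_sub_starProjection i)) hρ₀
  set R := ‖p + σ • x - (S i).starProjection (p + σ • x)‖ ^ 2
  have hshrink : Module.finrank ℝ E * ρ / 2 - 2 * t - ‖(S i).starProjection x‖ ^ 2 -
      2 * (t + L i) ≤ (‖x‖ ^ 2 - ‖(S i).starProjection x‖ ^ 2 - 2 * (t + L i)) * ρ := by
    have hnoise := mul_le_mul_of_nonneg_right hx.le_norm_sq hρ₀
    have hdev := mul_le_of_le_one_right
      (by positivity : 0 ≤ 2 * t + ‖(S i).starProjection x‖ ^ 2 + 2 * (t + L i)) hρ₁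
    linarith
  have hgrow : ‖x‖ ^ 2 * ρ' ≤ Module.finrank ℝ E * (1 + ε) * ρ' :=
    mul_le_mul_of_nonneg_right hx.norm_sq_le hρ'
  -- With `s = t + L i`, overfitting counts three times, hence `3 * (2 * finrank + 4 * s)`, and the
  -- two uses of the cross term cost `(2 + 2 / c) * s`.
  have hexcess : ‖x‖ ^ 2 * ρ' -
      (‖x‖ ^ 2 - ‖(S i).starProjection x‖ ^ 2 - 2 * (t + L i)) * ρ +
        (2 * ‖(S i).starProjection x‖ ^ 2 + 2 * (t + L i) / c) ≤
      (16 + 2 / c) * t + (1 + ε) * (Module.finrank ℝ E * ρ') := by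
    have hsplit : 2 * (t + L i) / c = 2 / c * t + 2 / c * L i := by ring
    linarith [hx.norm_sq_starProjection_le i]
  linarith [mul_le_mul_of_nonneg_left hexcess (sq_nonneg σ)]

variable [MeasurableSpace E] [BorelSpace E] {Ω : Type*} [MeasurableSpace Ω] {μ : Measure Ω}
  {p x : Ω → E}

theorem measureReal_inner_sub_starProjection_lt_le (hp : AEMeasurable p μ)
    (hx : HasLaw x (stdGaussian E) μ) (hpx : p ⟂ᵢ[μ] x) (S : Submodule ℝ E) (t : ℝ) :
    μ.real {ω | ⟪p ω - S.starProjection (p ω), x ω⟫ <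
      -(√(2 * t) * ‖p ω - S.starProjection (p ω)‖)} ≤ Real.exp (-t) :=
  measureReal_le_of_indepFun hp hx hpx
    (s := {y | ⟪y.1 - S.starProjection y.1, y.2⟫ < -(√(2 * t) * ‖y.1 - S.starProjection y.1‖)})
    (measurableSet_lt (by fun_prop) (by fun_prop))
    fun a => stdGaussian_real_inner_lt_le (a - S.starProjection a) t

theorem measureReal_not_isTypicalNoise_le [Fintype ι]
    (hL : ∑ i, Real.exp (-L i) ≤ 1) (hε₀ : 0 ≤ ε) (hε₁ : ε ≤ 1 / 2) (hp : AEMeasurable p μ)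
    (hx : HasLaw x (stdGaussian E) μ) (hpx : p ⟂ᵢ[μ] x) :
    μ.real {ω | ¬ IsTypicalNoise S L t ε (p ω) (x ω)} ≤
      3 * Real.exp (-t) + Real.exp (-(3 / 16 * ε ^ 2 * Module.finrank ℝ E)) := by
  have := hx.isProbabilityMeasure
  set long := {ω | Module.finrank ℝ E * (1 + ε) ≤ ‖x ω‖ ^ 2}
  set short := {ω | ‖x ω‖ ^ 2 ≤ Module.finrank ℝ E / 2 - 2 * t}
  set overfit := fun i =>
    {ω | 2 * Module.finrank ℝ (S i) + 4 * (t + L i) ≤ ‖(S i).starProjection (x ω)‖ ^ 2}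
  set aligned := fun i => {ω | ⟪p ω - (S i).starProjection (p ω), x ω⟫ <
    -(√(2 * (t + L i)) * ‖p ω - (S i).starProjection (p ω)‖)}
  have hlong : μ.real long ≤ _ :=
    (hx.measureReal_eq (measurableSet_le (by fun_prop) (by fun_prop))).trans_le
      (stdGaussian_real_norm_sq_ge_le hε₀ hε₁)
  have hshort : μ.real short ≤ _ :=
    (hx.measureReal_eq (measurableSet_le (by fun_prop) (by fun_prop))).trans_le
      (stdGaussian_real_norm_sq_le_le t)
  have hoverfit : μ.real (⋃ i, overfit i) ≤ _ := measureReal_iUnion_le_exp_neg hL fun i =>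
    (hx.measureReal_eq (measurableSet_le (by fun_prop) (by fun_prop))).trans_le
      (stdGaussian_real_norm_sq_starProjection_ge_le (S i) (t + L i))
  have haligned : μ.real (⋃ i, aligned i) ≤ _ := measureReal_iUnion_le_exp_neg hL fun i =>
    measureReal_inner_sub_starProjection_lt_le hp hx hpx (S i) (t + L i)
  have hsub : {ω | ¬ IsTypicalNoise S L t ε (p ω) (x ω)} ⊆
      (long ∪ short) ∪ ((⋃ i, overfit i) ∪ ⋃ i, aligned i) := fun ω hω => by
    by_contra hgood
    simp only [Set.mem_union, Set.mem_iUnion, not_or, not_exists] at hgood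
    obtain ⟨⟨hl, hs⟩, ho, ha⟩ := hgood
    exact hω ⟨(not_le.1 hl).le, (not_le.1 hs).le, fun i => (not_le.1 (ho i)).le,
      fun i => not_lt.1 (ha i)⟩
  linarith [measureReal_mono (μ := μ) hsub,
    measureReal_union_le (μ := μ) (long ∪ short) ((⋃ i, overfit i) ∪ ⋃ i, aligned i),
    measureReal_union_le (μ := μ) long short,
    measureReal_union_le (μ := μ) (⋃ i, overfit i) (⋃ i, aligned i)]

end PenalizedProjection

section Network

variable {n : ℕ}

/-- The unordered pairs of distinct nodes, which carry the weights of a network. -/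
abbrev Edge (n : ℕ) : Type := {e : Sym2 (Fin n) // ¬ e.IsDiag}

/-- The network with given edge weights. Edge weights form a Euclidean space, in which least squares
estimates are orthogonal projections. -/
noncomputable def networkOfEdges (x : EuclideanSpace ℝ (Edge n)) : Matrix (Fin n) (Fin n) ℝ :=
  Matrix.of fun u v => if h : u = v then 0 else x ⟨s(u, v), by simpa using h⟩

theorem finrank_euclideanSpace_edge (n : ℕ) :
    (Module.finrank ℝ (EuclideanSpace ℝ (Edge n)) : ℝ) = n * (n - 1) / 2 := by
  rw [finrank_euclideanSpace, Sym2.card_subtype_not_diag, Fintype.card_fin, Nat.cast_choose_two]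

theorem networkOfEdges_sub (x y : EuclideanSpace ℝ (Edge n)) :
    networkOfEdges x - networkOfEdges y = networkOfEdges (x - y) := by
  ext u v
  by_cases h : u = v <;> simp [networkOfEdges, h]

theorem sum_sum_ite_eq_two_mul_sum_sym2 {ι : Type*} [Fintype ι] [LinearOrder ι] (f : Sym2 ι → ℝ) :
    ∑ u, ∑ v, (if u = v then 0 else f s(u, v)) =
      2 * ∑ e : {e : Sym2 ι // ¬ e.IsDiag}, f e.1 := by
  have hlt : ∑ e : {e : Sym2 ι // ¬ e.IsDiag}, f e.1 =
      ∑ u, ∑ v, if u < v then f s(u, v) else 0 := by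
    rw [← Finset.sum_subtype {e : Sym2 ι | ¬ e.IsDiag} (by simp) f, ← Finset.sym2_univ,
      Finset.sum_sym2_filter_not_isDiag, ← Finset.sum_product', ← Finset.sum_filter]
    refine Finset.sum_congr ?_ fun _ _ => rfl
    ext ⟨u, v⟩
    simpa using fun h => ne_of_lt h
  have hgt : ∑ u, ∑ v, (if v < u then f s(u, v) else 0) =
      ∑ u, ∑ v, if u < v then f s(u, v) else 0 := by
    rw [Finset.sum_comm]
    simp only [Sym2.eq_swap]
  rw [hlt, two_mul]
  nth_rw 1 [← hgt]
  simp only [← Finset.sum_add_distrib]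
  refine Finset.sum_congr rfl fun u _ => Finset.sum_congr rfl fun v _ => ?_
  rcases lt_trichotomy u v with h | rfl | h
  · simp [h, h.ne, h.not_gt]
  · simp
  · simp [h, h.ne', h.not_gt]

theorem frobSq_networkOfEdges (x : EuclideanSpace ℝ (Edge n)) :
    frobSq (networkOfEdges x) = 2 * ‖x‖ ^ 2 := by
  rw [EuclideanSpace.real_norm_sq_eq, frobSq]
  convert sum_sum_ite_eq_two_mul_sum_sym2
    (fun e : Sym2 (Fin n) => if h : e.IsDiag then 0 else x ⟨e, h⟩ ^ 2) using 4 with u _ v _ e _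
  · by_cases huv : u = v <;> simp [networkOfEdges, huv]
  · simp [e.2]

theorem frobSq_networkOfEdges_sub (x y : EuclideanSpace ℝ (Edge n)) :
    frobSq (networkOfEdges x - networkOfEdges y) = 2 * ‖x - y‖ ^ 2 := by
  rw [networkOfEdges_sub, frobSq_networkOfEdges]

theorem criterion_networkOfEdges (C₁ C₂ C₃ : ℝ) (y q : EuclideanSpace ℝ (Edge n)) (K : ℕ) :
    criterion C₁ C₂ C₃ (networkOfEdges y) (networkOfEdges q) K =
      2 * (‖y - q‖ ^ 2 * (1 + penalty C₁ C₂ C₃ n K / (n * (n - 1)))) := by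
  rw [criterion, sigmaHatSq, frobSq_networkOfEdges_sub]
  ring

end Network

section Community

variable {n K : ℕ}

/-- The edge weights of the noiseless network whose edge between `u` and `v` has weight
`a u (z v) + a v (z u)`. All noiseless networks with communities `z` are of this form, with `γ`
split evenly between the two endpoints of an edge and `α` absorbed in the sociabilities, so that
they depend linearly on their parameter. -/
noncomputable def communityEdges (z : Fin n → Fin K) :
    (Fin n → Fin K → ℝ) →ₗ[ℝ] EuclideanSpace ℝ (Edge n) where
  toFun a := toLp 2 fun e =>
    Sym2.lift ⟨fun u v => a u (z v) + a v (z u), fun _ _ => add_comm _ _⟩ e.1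
  map_add' a b := by
    ext ⟨e, he⟩
    induction e with | _ u v
    simp only [Sym2.lift_mk, PiLp.add_apply, Pi.add_apply]
    ring
  map_smul' r a := by
    ext ⟨e, he⟩
    induction e with | _ u v
    simp only [Sym2.lift_mk, PiLp.smul_apply, Pi.smul_apply, smul_eq_mul, RingHom.id_apply]
    ring

/-- The space of edge weights of the noiseless networks with communities `z`. -/
noncomputable def communitySpace (z : Fin n → Fin K) : Submodule ℝ (EuclideanSpace ℝ (Edge n)) :=
  LinearMap.range (communityEdges z)

/-- The parameter in `communityEdges z` of the linear sociability network with intercepts `γ`,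
slopes `α` and sociabilities `Z`. -/
noncomputable def sociabilityCoeff (z : Fin n → Fin K) (γ : Sym2 (Fin K) → ℝ)
    (α : Fin K → Fin K → ℝ) (Z : Fin n → Fin K → ℝ) : Fin n → Fin K → ℝ :=
  fun u j => γ s(z u, j) / 2 + α (z u) j * Z u j

theorem finrank_communitySpace_le (z : Fin n → Fin K) :
    Module.finrank ℝ (communitySpace z) ≤ n * K := by
  refine (LinearMap.finrank_range_le _).trans ?_
  simp [Module.finrank_pi_fintype]

theorem measurable_communityEdges_sociabilityCoeff (z : Fin n → Fin K) (γ : Sym2 (Fin K) → ℝ)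
    (α : Fin K → Fin K → ℝ) :
    Measurable fun Z => communityEdges z (sociabilityCoeff z γ α Z) := by
  refine (communityEdges z).continuous_of_finiteDimensional.measurable.comp ?_
  unfold sociabilityCoeff
  fun_prop

theorem lsmNetwork_eq_networkOfEdges (z : Fin n → Fin K) (γ : Sym2 (Fin K) → ℝ)
    (α : Fin K → Fin K → ℝ) (Z : Fin n → Fin K → ℝ) (σ : ℝ) (ξ : Sym2 (Fin n) → ℝ) :
    lsmNetwork z γ α Z σ ξ = networkOfEdges
      (communityEdges z (sociabilityCoeff z γ α Z) + σ • toLp 2 fun e : Edge n => ξ e.1) := by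
  ext u v
  by_cases h : u = v
  · simp [lsmNetwork, networkOfEdges, h]
  · simp only [lsmNetwork, networkOfEdges, communityEdges, sociabilityCoeff, Matrix.of_apply, h,
      if_false, dite_false, LinearMap.coe_mk, AddHom.coe_mk, PiLp.add_apply, PiLp.smul_apply,
      Sym2.lift_mk, smul_eq_mul, Sym2.eq_swap (a := z v) (b := z u)]
    ring

theorem noiselessNetworks_eq_image (z : Fin n → Fin K) :
    noiselessNetworks z = networkOfEdges '' communitySpace z := by
  ext P
  constructor
  · rintro ⟨γ, α, Z, rfl⟩
    refine ⟨communityEdges z (sociabilityCoeff z γ α Z), LinearMap.mem_range_self _ _, ?_⟩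
    rw [lsmNetwork_eq_networkOfEdges, zero_smul, add_zero]
  · rintro ⟨_, ⟨a, rfl⟩, rfl⟩
    have hcoeff : sociabilityCoeff z 0 1 a = a := by
      ext u j
      simp [sociabilityCoeff]
    exact ⟨0, 1, a, by rw [lsmNetwork_eq_networkOfEdges, zero_smul, add_zero, hcoeff]⟩

theorem isInducedEstimate_networkOfEdges_iff {z : Fin n → Fin K}
    {y : EuclideanSpace ℝ (Edge n)} {P : Matrix (Fin n) (Fin n) ℝ} :
    IsInducedEstimate (networkOfEdges y) z P ↔
      P = networkOfEdges ((communitySpace z).starProjection y) := by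
  have hproj := (communitySpace z).starProjection_apply_mem y
  rw [IsInducedEstimate, noiselessNetworks_eq_image]
  constructor
  · rintro ⟨⟨q, hq, rfl⟩, hmin⟩
    have hle := hmin _ ⟨_, hproj, rfl⟩
    rw [frobSq_networkOfEdges_sub, frobSq_networkOfEdges_sub, norm_sub_sq_eq_add_of_mem _ y hq]
      at hle
    have hzero : ‖(communitySpace z).starProjection y - q‖ ^ 2 = 0 :=
      le_antisymm (by linarith) (sq_nonneg _)
    rw [sub_eq_zero.1 (norm_eq_zero.1 (sq_eq_zero_iff.1 hzero))]
  · rintro rfl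
    refine ⟨⟨_, hproj, rfl⟩, ?_⟩
    rintro _ ⟨q, hq, rfl⟩
    rw [frobSq_networkOfEdges_sub, frobSq_networkOfEdges_sub, norm_sub_sq_eq_add_of_mem _ y hq]
    linarith [sq_nonneg ‖(communitySpace z).starProjection y - q‖]

theorem exists_surjective_communitySpace_le (z : Fin n → Fin K) :
    ∃ (K' : ℕ) (z' : Fin n → Fin K'), K' ≤ K ∧ Function.Surjective z' ∧
      communitySpace z ≤ communitySpace z' := by
  classical
  let e := Fintype.equivFin (Set.range z)
  refine ⟨_, e ∘ Set.rangeFactorization z, ?_, e.surjective.comp Set.rangeFactorization_surjective,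
    ?_⟩
  · exact (Fintype.card_le_of_injective _ Subtype.val_injective).trans_eq (Fintype.card_fin K)
  · rintro _ ⟨a, rfl⟩
    exact ⟨fun u j => a u (e.symm j), by simp [communityEdges]⟩

end Community

section Penalty

variable {C₁ C₂ C₃ : ℝ} {n K : ℕ}

theorem complexity_mono (h₁ : 0 ≤ C₁) (h₂ : 0 ≤ C₂) (h₃ : 0 ≤ C₃) (n : ℕ) :
    Monotone (complexity C₁ C₂ C₃ n) := by
  intro K K' h
  have hK : (K : ℝ) ≤ K' := by exact_mod_cast h
  have hlog : Real.log K ≤ Real.log K' := by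
    rcases Nat.eq_zero_or_pos K with rfl | hpos
    · simpa using Real.log_natCast_nonneg K'
    · exact Real.log_le_log (by exact_mod_cast hpos) hK
  have := Real.log_natCast_nonneg n
  unfold complexity
  gcongr

theorem penalty_nonneg (h₁ : 0 ≤ C₁) (h₂ : 0 ≤ C₂) (h₃ : 0 ≤ C₃) (n K : ℕ) :
    0 ≤ penalty C₁ C₂ C₃ n K := by
  have := Real.log_natCast_nonneg n
  have := Real.log_natCast_nonneg K
  unfold penalty complexity
  positivity

theorem natCast_mul_sub_one_nonneg (n : ℕ) : 0 ≤ (n : ℝ) * (n - 1) := by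
  have h := (Nat.cast_nonneg (α := ℝ) (n.choose 2))
  rw [Nat.cast_choose_two] at h
  linarith

theorem IsAdmissible.penalty_le (h : IsAdmissible C₁ C₂ C₃ n K) :
    penalty C₁ C₂ C₃ n K ≤ n * (n - 1) := by
  unfold IsAdmissible at h
  unfold penalty
  linarith

theorem IsAdmissible.mul_penalty_div (h : IsAdmissible C₁ C₂ C₃ n K) (h₁ : 0 ≤ C₁) (h₂ : 0 ≤ C₂)
    (h₃ : 0 ≤ C₃) :
    n * (n - 1) * (penalty C₁ C₂ C₃ n K / (n * (n - 1))) = penalty C₁ C₂ C₃ n K :=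
  mul_div_cancel_of_imp' fun hn =>
    le_antisymm (h.penalty_le.trans_eq hn) (penalty_nonneg h₁ h₂ h₃ n K)

end Penalty

section Clustering

variable {n : ℕ}

/-- The number of nats needed to describe a clustering of `n` nodes into `K` communities. It weights
the clusterings in union bounds. -/
noncomputable def clusteringCost (n K : ℕ) : ℝ := Real.log n + n * Real.log K

/-- The clusterings of `n` nodes into at most `n` communities, over which union bounds are taken.
They include relabellings and empty communities, which the cost of a clustering allows for. -/
abbrev Clustering (n : ℕ) : Type := Σ K : Fin (n + 1), Fin n → Fin K

theorem clusteringCost_nonneg (n K : ℕ) : 0 ≤ clusteringCost n K := by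
  have := Real.log_natCast_nonneg n
  have := Real.log_natCast_nonneg K
  unfold clusteringCost
  positivity

-- For `0 < n`, each number `1, …, n` of communities contributes `1 / n`.
theorem sum_exp_neg_clusteringCost (n : ℕ) :
    ∑ i : Clustering n, Real.exp (-clusteringCost n i.1) = 1 := by
  rcases Nat.eq_zero_or_pos n with rfl | hn
  · simp [clusteringCost]
  have hterm (k : Fin n) :
      ∑ _z : Fin n → Fin (k + 1), Real.exp (-clusteringCost n (k + 1)) = (n : ℝ)⁻¹ := by
    have hexp : Real.exp (-clusteringCost n (k + 1)) = (n * (k + 1 : ℝ) ^ n)⁻¹ := by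
      rw [clusteringCost, Real.exp_neg, Real.exp_add, Real.exp_log (by positivity),
        Real.exp_nat_mul, Real.exp_log (by positivity)]
      push_cast
      rfl
    rw [Finset.sum_const, Finset.card_univ, Fintype.card_fun, Fintype.card_fin, Fintype.card_fin,
      nsmul_eq_mul, hexp, mul_inv]
    push_cast
    field_simp
  have hempty : IsEmpty (Fin n → Fin (0 : Fin (n + 1))) := ⟨fun f => (f ⟨0, hn⟩).elim0⟩
  rw [Fintype.sum_sigma, Fin.sum_univ_succ, Fintype.sum_empty, zero_add]
  simp only [Fin.val_succ, hterm]
  simp [hn.ne']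

end Clustering

section Estimate

variable {C₁ C₂ C₃ : ℝ} {n K : ℕ}

theorem mul_finrank_communitySpace_add_mul_clusteringCost_le (h₁ : 0 ≤ C₁) (h₂ : 0 ≤ C₂) (C₃ : ℝ)
    (z : Fin n → Fin K) :
    C₁ * Module.finrank ℝ (communitySpace z) + C₃ * clusteringCost n K ≤
      complexity C₁ C₂ C₃ n K := by
  have hdim : (Module.finrank ℝ (communitySpace z) : ℝ) ≤ n * K := by
    exact_mod_cast finrank_communitySpace_le z
  have hslopes : 0 ≤ C₂ * (K : ℝ) ^ 2 * Real.log n :=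
    mul_nonneg (by positivity) (Real.log_natCast_nonneg n)
  rw [clusteringCost, complexity]
  linarith [mul_le_mul_of_nonneg_left hdim h₁]

theorem IsPenalizedEstimate.exists_clustering {y p : EuclideanSpace ℝ (Edge n)}
    {z : Fin n → Fin K} {P : Matrix (Fin n) (Fin n) ℝ}
    (hP : IsPenalizedEstimate C₁ C₂ C₃ (networkOfEdges y) P) (h₁ : 0 ≤ C₁) (h₂ : 0 ≤ C₂)
    (h₃ : 0 ≤ C₃) (hp : p ∈ communitySpace z) (hK : IsAdmissible C₁ C₂ C₃ n K) :
    ∃ i : Clustering n, IsAdmissible C₁ C₂ C₃ n i.1 ∧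
      P = networkOfEdges ((communitySpace i.2).starProjection y) ∧
      ‖y - (communitySpace i.2).starProjection y‖ ^ 2 *
          (1 + penalty C₁ C₂ C₃ n i.1 / (n * (n - 1))) ≤
        ‖y - p‖ ^ 2 * (1 + penalty C₁ C₂ C₃ n K / (n * (n - 1))) := by
  obtain ⟨Khat, zhat, hsurj, hadm, hind, hmin⟩ := hP
  obtain ⟨K', z', hK', hsurj', hle⟩ := exists_surjective_communitySpace_le z
  have hKhat : Khat ≤ n := by simpa using Fintype.card_le_of_surjective zhat hsurj
  have hcomp := complexity_mono h₁ h₂ h₃ n hK'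
  have hcrit := hmin K' z' _ hsurj' (hcomp.trans hK) (isInducedEstimate_networkOfEdges_iff.2 rfl)
  rw [isInducedEstimate_networkOfEdges_iff] at hind
  rw [hind, criterion_networkOfEdges, criterion_networkOfEdges] at hcrit
  refine ⟨⟨⟨Khat, Nat.lt_succ_of_le hKhat⟩, zhat⟩, hadm, hind,
    (le_of_mul_le_mul_left hcrit two_pos).trans ?_⟩
  have hfit : ‖y - (communitySpace z').starProjection y‖ ^ 2 ≤ ‖y - p‖ ^ 2 := by
    rw [norm_sub_sq_eq_add_of_mem _ y (hle hp)]
    exact le_add_of_nonneg_right (sq_nonneg _)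
  have hpen : penalty C₁ C₂ C₃ n K' ≤ penalty C₁ C₂ C₃ n K :=
    mul_le_mul_of_nonneg_left hcomp zero_le_four
  have := penalty_nonneg h₁ h₂ h₃ n K'
  have := natCast_mul_sub_one_nonneg n
  gcongr

theorem IsTypicalNoise.frobSq_sub_le {c σ t ε : ℝ} {p x : EuclideanSpace ℝ (Edge n)}
    {z : Fin n → Fin K} {P : Matrix (Fin n) (Fin n) ℝ}
    (hx : IsTypicalNoise (fun i : Clustering n => communitySpace i.2)
      (fun i => clusteringCost n i.1) t ε p x)
    (hc₀ : 0 < c) (hc₁ : c < 1) (h₁ : 6 ≤ C₁) (h₂ : 0 ≤ C₂) (h₃ : 14 + 2 / c ≤ C₃) (hσ : 0 ≤ σ)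
    (ht : 0 ≤ t) (hp : p ∈ communitySpace z) (hK : IsAdmissible C₁ C₂ C₃ n K)
    (hP : IsPenalizedEstimate C₁ C₂ C₃ (networkOfEdges (p + σ • x)) P) :
    frobSq (networkOfEdges p - P) ≤
      σ ^ 2 / (1 - c) * ((32 + 4 / c) * t + (1 + ε) * penalty C₁ C₂ C₃ n K) := by
  have h₁' : 0 ≤ C₁ := by linarith
  have h₃' : 0 ≤ C₃ := le_trans (by positivity) h₃
  have hn := natCast_mul_sub_one_nonneg n
  obtain ⟨i, hi, rfl, hcrit⟩ := hP.exists_clustering h₁' h₂ h₃' hp hK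
  rw [add_sub_cancel_left, norm_smul, mul_pow, Real.norm_eq_abs, sq_abs] at hcrit
  have hcost : 6 * Module.finrank ℝ (communitySpace i.2) +
      (14 + 2 / c) * clusteringCost n i.1 ≤ complexity C₁ C₂ C₃ n i.1 := by
    refine le_trans ?_ (mul_finrank_communitySpace_add_mul_clusteringCost_le h₁' h₂ C₃ i.2)
    have := clusteringCost_nonneg n i.1
    gcongr
  have hbudget : complexity C₁ C₂ C₃ n i.1 =
      n * (n - 1) / 2 * (penalty C₁ C₂ C₃ n i.1 / (n * (n - 1))) / 2 := by
    linarith [hi.mul_penalty_div h₁' h₂ h₃', penalty.eq_1 C₁ C₂ C₃ n i.1]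
  have horacle := hx.one_sub_mul_norm_sub_starProjection_sq_le hc₀ hσ ht
    (clusteringCost_nonneg n i.1) (div_nonneg (penalty_nonneg h₁' h₂ h₃' n i.1) hn)
    (div_le_one_of_le₀ hi.penalty_le hn) (div_nonneg (penalty_nonneg h₁' h₂ h₃' n K) hn)
    (by rwa [finrank_euclideanSpace_edge, ← hbudget]) hcrit
  have hpen : Module.finrank ℝ (EuclideanSpace ℝ (Edge n)) *
      (penalty C₁ C₂ C₃ n K / (n * (n - 1))) = penalty C₁ C₂ C₃ n K / 2 := by
    rw [finrank_euclideanSpace_edge]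
    linarith [hK.mul_penalty_div h₁' h₂ h₃']
  rw [hpen] at horacle
  rw [frobSq_networkOfEdges_sub, div_mul_eq_mul_div, le_div_iff₀ (sub_pos.2 hc₁)]
  calc
    _ = 2 * ((1 - c) * ‖p - (communitySpace i.2).starProjection (p + σ • x)‖ ^ 2) := by ring
    _ ≤ 2 * (σ ^ 2 * ((16 + 2 / c) * t + (1 + ε) * (penalty C₁ C₂ C₃ n K / 2))) :=
      mul_le_mul_of_nonneg_left horacle zero_le_two
    _ = _ := by ring

variable {Ω : Type*} [MeasurableSpace Ω] {μ : Measure Ω}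

theorem IsNormalLSMInput.hasLaw_error {Z : Fin n → Fin K → Ω → ℝ}
    {ξ : Sym2 (Fin n) → Ω → ℝ} (h : IsNormalLSMInput μ Z ξ) :
    HasLaw (fun ω => toLp 2 fun e : Edge n => ξ e.1 ω)
      (stdGaussian (EuclideanSpace ℝ (Edge n))) μ := by
  have hvec : HasLaw (toLp 2) (stdGaussian (EuclideanSpace ℝ (Edge n)))
      (Measure.pi fun _ => gaussianReal 0 1) := ⟨by fun_prop, map_pi_eq_stdGaussian⟩
  exact hvec.comp (h.error_indep.hasLaw_pi fun e => h.error_law e.1 e.2)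

theorem IsNormalLSMInput.aemeasurable_sociability {Z : Fin n → Fin K → Ω → ℝ}
    {ξ : Sym2 (Fin n) → Ω → ℝ} (h : IsNormalLSMInput μ Z ξ) :
    AEMeasurable (fun ω u j => Z u j ω) μ :=
  aemeasurable_pi_lambda _ fun u => aemeasurable_pi_lambda _ fun j =>
    (h.sociability_law u j).aemeasurable

theorem theorem2_general {c σ t ε : ℝ} (hc₀ : 0 < c) (hc₁ : c < 1)
    (h₁ : 6 ≤ C₁) (h₂ : 0 ≤ C₂) (h₃ : 14 + 2 / c ≤ C₃) (hσ : 0 ≤ σ) {z : Fin n → Fin K}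
    {p x : Ω → EuclideanSpace ℝ (Edge n)} (hp : AEMeasurable p μ)
    (hpz : ∀ ω, p ω ∈ communitySpace z) (hx : HasLaw x (stdGaussian _) μ) (hpx : p ⟂ᵢ[μ] x)
    (hK : IsAdmissible C₁ C₂ C₃ n K) (ht : 0 ≤ t) (hε₀ : 0 ≤ ε) (hε₁ : ε ≤ 1 / 2) :
    ∃ E : Set Ω, MeasurableSet E ∧
      1 - 3 * Real.exp (-t) - Real.exp (-(3 / 32 * ε ^ 2 * ((n : ℝ) * ((n : ℝ) - 1)))) ≤
        μ.real E ∧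
      ∀ ω ∈ E, ∀ Phat : Matrix (Fin n) (Fin n) ℝ,
        IsPenalizedEstimate C₁ C₂ C₃ (networkOfEdges (p ω + σ • x ω)) Phat →
          frobSq (networkOfEdges (p ω) - Phat) ≤
            σ ^ 2 / (1 - c) * ((32 + 4 / c) * t + (1 + ε) * penalty C₁ C₂ C₃ n K) := by
  have := hx.isProbabilityMeasure
  obtain ⟨E, hE, hμE, htypical⟩ := exists_measurableSet_of_measureReal_not_le
    (measureReal_not_isTypicalNoise_le (S := fun i : Clustering n => communitySpace i.2) (t := t)
      (sum_exp_neg_clusteringCost n).le hε₀ hε₁ hp hx hpx)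
  have hrate : 3 / 16 * ε ^ 2 * (Module.finrank ℝ (EuclideanSpace ℝ (Edge n)) : ℝ) =
      3 / 32 * ε ^ 2 * (n * (n - 1)) := by
    rw [finrank_euclideanSpace_edge]
    ring
  rw [hrate] at hμE
  exact ⟨E, hE, by linarith, fun ω hω _ hPhat =>
    (htypical ω hω).frobSq_sub_le hc₀ hc₁ h₁ h₂ h₃ hσ ht (hpz ω) hK hPhat⟩

end Estimate

/-- `Kstar` is the true number of communities, `A ω` the observed network, `Pstar ω` the network
with the same generating process and `σ` set to `0`, and `E` the event of the given probability. -/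
theorem theorem2 :
    ∃ C₁ > (0 : ℝ), ∃ C₂ > (0 : ℝ), ∀ c : ℝ, 0 < c → c < 1 →
    ∃ C₃ > (0 : ℝ), ∃ C > (0 : ℝ),
    ∀ (Ω : Type*) [MeasurableSpace Ω] (μ : MeasureTheory.Measure Ω)
      [MeasureTheory.IsProbabilityMeasure μ]
      (n Kstar : ℕ) (zstar : Fin n → Fin Kstar)
      (γ : Sym2 (Fin Kstar) → ℝ) (α : Fin Kstar → Fin Kstar → ℝ) (σ : ℝ)
      (Z : Fin n → Fin Kstar → Ω → ℝ) (ξ : Sym2 (Fin n) → Ω → ℝ)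
      (A Pstar : Ω → Matrix (Fin n) (Fin n) ℝ),
      0 ≤ σ →
      IsNormalLSMInput μ Z ξ →
      (∀ ω, A ω = lsmNetwork zstar γ α (fun u j => Z u j ω) σ (fun e => ξ e ω)) →
      (∀ ω, Pstar ω = lsmNetwork zstar γ α (fun u j => Z u j ω) 0 (fun e => ξ e ω)) →
      IsAdmissible C₁ C₂ C₃ n Kstar →
      ∀ t ε : ℝ, 0 < t → 0 ≤ ε → ε < 1 / 2 →
      ∃ E : Set Ω, MeasurableSet E ∧
        1 - 3 * Real.exp (-t) - Real.exp (-(3 / 32 * ε ^ 2 * ((n : ℝ) * ((n : ℝ) - 1)))) ≤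
          μ.real E ∧
        ∀ ω ∈ E, ∀ Phat : Matrix (Fin n) (Fin n) ℝ, IsPenalizedEstimate C₁ C₂ C₃ (A ω) Phat →
          frobSq (Pstar ω - Phat) ≤
            σ ^ 2 / (1 - c) * (C * t + (1 + ε) * penalty C₁ C₂ C₃ n Kstar) := by
  refine ⟨6, by norm_num, 1, one_pos, fun c hc₀ hc₁ => ⟨14 + 2 / c, by positivity, 32 + 4 / c,
    by positivity, ?_⟩⟩
  intro Ω _ μ _ n K z γ α σ Z ξ A Pstar hσ hin hA hPstar hK t ε ht hε₀ hε₁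
  have hf := measurable_communityEdges_sociabilityCoeff z γ α
  simpa only [hA, hPstar, lsmNetwork_eq_networkOfEdges, zero_smul, add_zero,
    Function.comp_apply] using
    theorem2_general hc₀ hc₁ le_rfl zero_le_one le_rfl hσ
      (hf.comp_aemeasurable hin.aemeasurable_sociability) (fun _ => LinearMap.mem_range_self _ _)
      hin.hasLaw_error (hin.sociability_error_indep.comp hf (measurable_toLp 2 _)) hK ht.le hε₀
      hε₁.le
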